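/- Let $S$ be a commutative monoid with identity $1$. A left $S$-act is a nonempty set $A$ with an action of $S$ such that $s_1(s_2a)=(s_1s_2)a$ and $1a=a$; it is regarded as a structure of the first-order language with one unary function symbol for each $s\in S$. An element $a\in A$ is act-regular if there is a homomorphism of $S$-acts $\varphi: Sa\to S$ with $\varphi(a)a=a$, and $A$ is regular if all its elements are act-regular. Let $\mathfrak R$ be the class of all regular $S$-acts, and let $R\subseteq S$ be the union of all regular subacts of the $S$-act $S$; it is a subsemigroup of $S$, and we assume that $R\neq\varnothing$. A primitive formula is a formula $\exists\bar x(\Phi_0\wedge\dots\wedge\Phi_k)$ with all $\Phi_i$ atomic. For a structure $C$, a primitive formula $\Phi(\bar x,\bar y)$ and a tuple $\bar a$ in $C$, the set $\Phi(C,\bar a)=\{\bar b: C\models\Phi(\bar b,\bar a)\}$ is called a primitive set, and two sets $\Phi(C,\bar a)$, $\Phi(C,\bar b)$ given by the same formula $\Phi$ are called primitive copies. A primitive equivalence $\alpha$ is an equivalence relation on a set $\mathrm{dom}(\alpha)$ of $n$-tuples of $C$ which is defined in $C$ by a primitive formula $\Phi(\bar x_1,\bar x_2)$. A generalized primitive set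 is a set $X^*/\alpha=\{\bar a/\alpha:\bar a\in X^*\}$, where $\alpha$ is a primitive equivalence and $X^*\subseteq\mathrm{dom}(\alpha)$ is an intersection of a family of primitive sets. A theory $T$ is primitive normal if in every model $C$ of $T$ any two primitive copies are equal or disjoint. It is antiadditive if it is primitive normal and in no model $C$ of $T$ (in particular, in no large saturated one) is there an infinite generalized primitive set $X^*/\alpha$ which is an abelian group under an operation $+$ defined by a primitive formula with parameters, that is, such that for some primitive formula $\Phi(\bar x,\bar y,\bar z,\bar u)$ and some tuple $\bar d$ in $C$ one has $C\models\Phi(\bar x,\bar y,\bar z,\bar d)\iff \bar x/\alpha+\bar y/\alpha=\bar z/\alpha$ for all $\bar x,\bar y,\bar z\in X^*$. An axiomatizable class of structures (the class of all models of some theory) is primitive normal, respectively antiadditive, if the set of all sentences true in all its members is. A semigroup $T$ is linearly ordered if for all $a,b\in T$ either $Ta\subseteq Tb$ or $Tb\subseteq Ta$. Suppose that the class $\mathfrak R$ is axiomatizable. Then the following conditions are equivalent: 1. the class $\mathfrak R$ is primitive normal; 2. the class $\mathfrak R$ is antiadditive; 3. the semigroup $R$ is linearly ordered. -/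

import Mathlib

open CategoryTheory

universe u v w

namespace PrimitiveModelTheory

open FirstOrder FirstOrder.Language

variable {L : FirstOrder.Language.{u, v}}

/-- Finite nonempty conjunctions of atomic formulas. -/
inductive IsConjAtomic {α : Type*} {n : ℕ} : L.BoundedFormula α n → Prop
  | atomic {φ : L.BoundedFormula α n} (h : φ.IsAtomic) : IsConjAtomic φ
  | inf {φ ψ : L.BoundedFormula α n} (hφ : IsConjAtomic φ) (hψ : IsConjAtomic ψ) :
      IsConjAtomic (φ ⊓ ψ)

/-- Primitive formulas `∃ x₀ … x_{m-1}, (Φ₀ ∧ ⋯ ∧ Φ_k)` with all `Φ_i` atomic; the free variables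
are indexed by `α`. -/
def IsPrimitiveFormula {α : Type*} (φ : L.Formula α) : Prop :=
  ∃ (m : ℕ) (ψ : L.BoundedFormula α m), IsConjAtomic ψ ∧ φ = ψ.exs

section Sets

variable (C : Type w) [L.Structure C]

/-- The set `Φ(C, a)` of all tuples `b` of `C` such that `C ⊨ Φ(b, a)`. -/
def solutionSet {n m : ℕ} (φ : L.Formula (Fin n ⊕ Fin m)) (a : Fin m → C) : Set (Fin n → C) :=
  {b | φ.Realize (Sum.elim b a)}

variable (L)

/-- Primitive sets of `n`-tuples: solution sets of primitive formulas with parameters. -/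
def IsPrimitiveSet {n : ℕ} (X : Set (Fin n → C)) : Prop :=
  ∃ (m : ℕ) (φ : L.Formula (Fin n ⊕ Fin m)) (a : Fin m → C),
    IsPrimitiveFormula φ ∧ X = solutionSet C φ a

/-- Primitive copies: solution sets of one primitive formula for two tuples of parameters. -/
def ArePrimitiveCopies {n : ℕ} (X Y : Set (Fin n → C)) : Prop :=
  ∃ (m : ℕ) (φ : L.Formula (Fin n ⊕ Fin m)) (a b : Fin m → C),
    IsPrimitiveFormula φ ∧ X = solutionSet C φ a ∧ Y = solutionSet C φ b

/-- Intersections of families of primitive sets. -/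
def IsDeltaPrimitiveSet {n : ℕ} (X : Set (Fin n → C)) : Prop :=
  ∃ F : Set (Set (Fin n → C)), (∀ Y ∈ F, IsPrimitiveSet L C Y) ∧ X = ⋂₀ F

/-- `r` is an equivalence relation on its domain `{a | r a a}` and is defined in `C` by a primitive
formula without parameters. (A symmetric and transitive relation is the same thing as
an equivalence relation on the set `{a | r a a}`.) -/
def IsPrimitiveEquivalence {n : ℕ} (r : (Fin n → C) → (Fin n → C) → Prop) : Prop :=
  (∃ φ : L.Formula (Fin n ⊕ Fin n), IsPrimitiveFormula φ ∧
    ∀ a b, r a b ↔ φ.Realize (Sum.elim a b)) ∧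
  (∀ a b, r a b → r b a) ∧ (∀ a b c, r a b → r b c → r a c)

variable {L C}

/-- The class `a / r`. -/
def classOf {n : ℕ} (r : (Fin n → C) → (Fin n → C) → Prop) (a : Fin n → C) : Set (Fin n → C) :=
  {b | r a b}

/-- The quotient `X / r = {a / r | a ∈ X}`, as a set of classes. -/
def quotientSet {n : ℕ} (r : (Fin n → C) → (Fin n → C) → Prop) (X : Set (Fin n → C)) :
    Set (Set (Fin n → C)) :=
  classOf r '' X

variable (L C)

/-- `X / r` is a generalized primitive set with basis `X` and generative equivalence `r`. -/
def IsGeneralizedPrimitive {n : ℕ} (r : (Fin n → C) → (Fin n → C) → Prop)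
    (X : Set (Fin n → C)) : Prop :=
  IsDeltaPrimitiveSet L C X ∧ IsPrimitiveEquivalence L C r ∧ ∀ a ∈ X, r a a

/-- `X / r` is an abelian group under an operation defined by a primitive formula
`Φ(x, y, z, d)` with a tuple of parameters `d`: for `x, y, z ∈ X`, the formula holds if and only if
`x / r + y / r = z / r`. -/
def IsPrimitiveAbelianGroup {n : ℕ} (r : (Fin n → C) → (Fin n → C) → Prop)
    (X : Set (Fin n → C)) : Prop :=
  ∃ (_ : AddCommGroup (quotientSet r X)) (m : ℕ)
    (φ : L.Formula (Fin n ⊕ (Fin n ⊕ (Fin n ⊕ Fin m)))) (d : Fin m → C),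
    IsPrimitiveFormula φ ∧
    ∀ x y z : X,
      φ.Realize (Sum.elim x.1 (Sum.elim y.1 (Sum.elim z.1 d))) ↔
        (⟨classOf r x.1, x.1, x.2, rfl⟩ : quotientSet r X) + ⟨classOf r y.1, y.1, y.2, rfl⟩ =
          ⟨classOf r z.1, z.1, z.2, rfl⟩

/-- Any two primitive copies in `C` are equal or disjoint. -/
def PrimitiveCopiesEqOrDisjoint : Prop :=
  ∀ (n : ℕ) (X Y : Set (Fin n → C)), ArePrimitiveCopies L C X Y → X = Y ∨ X ∩ Y = ∅

/-- There is no infinite generalized primitive set in `C` which is an abelian group under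
an operation defined by a primitive formula. -/
def NoInfinitePrimitiveGroup : Prop :=
  ∀ (n : ℕ) (r : (Fin n → C) → (Fin n → C) → Prop) (X : Set (Fin n → C)),
    IsGeneralizedPrimitive L C r X → (quotientSet r X).Infinite →
      ¬ IsPrimitiveAbelianGroup L C r X

end Sets

/-- A (possibly incomplete) theory is primitive normal if primitive copies are equal or disjoint in
each of its models. This property of a model is elementary, so it is the same to ask for it
in one large saturated model of each completion. -/
def TheoryPrimitiveNormal (T : L.Theory) : Prop :=
  ∀ C : Theory.ModelType.{u, v, w} T, PrimitiveCopiesEqOrDisjoint L C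

/-- A (possibly incomplete) theory is antiadditive if it is primitive normal and no model of it,
in particular no large saturated one, has an infinite generalized primitive set which is
an abelian group under an operation defined by a primitive formula. -/
def TheoryAntiadditive (T : L.Theory) : Prop :=
  TheoryPrimitiveNormal.{u, v, w} T ∧
    ∀ C : Theory.ModelType.{u, v, w} T, NoInfinitePrimitiveGroup L C

/-- A class of nonempty structures is axiomatizable if it is the class of models of a theory. -/
def IsAxiomatizable (K : Set (Bundled.{w} L.Structure)) : Prop :=
  ∃ T : L.Theory, ∀ A : Bundled.{w} L.Structure, A ∈ K ↔ Nonempty A ∧ A ⊨ T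

/-- The theory of a class of structures: all sentences true in each member of the class. -/
def theoryOfClass (K : Set (Bundled.{w} L.Structure)) : L.Theory :=
  {φ | ∀ A ∈ K, A ⊨ φ}

def ClassPrimitiveNormal (K : Set (Bundled.{w} L.Structure)) : Prop :=
  TheoryPrimitiveNormal.{u, v, w} (theoryOfClass K)

def ClassAntiadditive (K : Set (Bundled.{w} L.Structure)) : Prop :=
  TheoryAntiadditive.{u, v, w} (theoryOfClass K)

end PrimitiveModelTheory

namespace RegularActs

/-- The function symbols of the language of acts: one unary symbol for each `s : S`. -/
inductive ActFunctions (S : Type u) : ℕ → Type u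
  | smul (s : S) : ActFunctions S 1

/-- The language of acts over `S`; it has no relation symbols. -/
def actLanguage (S : Type u) : FirstOrder.Language.{u, 0} where
  Functions := ActFunctions S
  Relations := fun _ => Empty

section

variable (S : Type u) [Monoid S]

/-- `a` is act-regular: there is a homomorphism of left acts `f : S a → S` with `f(a) a = a`.
Here `MulAction.orbit S a` is the cyclic subact `S a = {s a | s ∈ S}`. -/
def IsActRegularElement {A : Type v} [MulAction S A] (a : A) : Prop :=
  ∃ f : MulAction.orbit S a →[S] S, f ⟨a, MulAction.mem_orbit_self a⟩ • a = a

def IsRegularAct (A : Type v) [MulAction S A] : Prop :=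
  ∀ a : A, IsActRegularElement S a

/-- The class of (nonempty) regular left `S`-acts, as structures of the language of acts. -/
def regularActs : Set (Bundled.{u} (actLanguage S).Structure) :=
  {A | Nonempty A ∧ ∃ _ : MulAction S A,
    (∀ (s : S) (a : A),
      FirstOrder.Language.Structure.funMap (L := actLanguage S) (ActFunctions.smul s) ![a] = s • a) ∧
    IsRegularAct S A}

/-- The union `R` of all regular subacts of the left act `S` over itself, as a semigroup under
the multiplication of `S`. -/
def regularPart : Subsemigroup S where
  carrier := {x | ∃ P : SubMulAction S S, IsRegularAct S P ∧ x ∈ P}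
  mul_mem' := by
    rintro a b - ⟨P, hP, hb⟩
    exact ⟨P, hP, P.smul_mem a hb⟩

end

/-- A semigroup `T` is linearly ordered if `T a ⊆ T b` or `T b ⊆ T a` for all `a, b ∈ T`. -/
def IsLinearlyOrderedSemigroup (T : Type u) [Semigroup T] : Prop :=
  ∀ a b : T, Set.range (fun t : T => t * a) ⊆ Set.range (fun t : T => t * b) ∨
    Set.range (fun t : T => t * b) ⊆ Set.range (fun t : T => t * a)

end RegularActs

/-! Linear order gives antiadditivity through a conservative Mal'cev operation. When `R` is linearly
ordered, the idempotents of `R` fixing three given elements of a regular act have a common upper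
bound, so any two scalars are comparable under divisibility on those elements
(`IsRegularAct.dividesLocally`). Hence `malcev` preserves every equation `s • u = t • v`, and so
every primitive formula. The identities `m(a, a, c) = c` and `m(a, b, a) = b` make primitive copies
equal or disjoint.

Since `m(a, b, c)` is always `b` or `c`, in a primitive abelian group a sum has a representative
whose coordinates come from those of the summands. Thus `k` elements lie in a subgroup of size at
most `(k + 1) ^ n`, while an infinite abelian group in which finitely generated subgroups are finite
has one with at most `k` generators and at least `2 ^ k` elements.

Conversely, primitive normality is tested on `∃ z, x = a z ∧ y = b z` (`exists_link`). In `R` itself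
it bounds two idempotents above; in three glued copies of `R` it makes any two multiples of one
idempotent comparable. -/

namespace RegularActs

open FirstOrder FirstOrder.Language PrimitiveModelTheory

/-! ### Regular elements, idempotents of `R`, and local comparability of scalars. -/

section Algebra

variable {S : Type u} [CommMonoid S]

/-- The idempotent is the image of `a`; the last condition says that `s • a ↦ s * e` is well
defined. -/
theorem isActRegularElement_iff {A : Type v} [MulAction S A] (a : A) :
    IsActRegularElement S a ↔
      ∃ e : S, e * e = e ∧ e • a = a ∧ ∀ s t : S, s • a = t • a → s * e = t * e := by
  constructor
  · rintro ⟨f, hf⟩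
    have key : ∀ (s : S), f ⟨s • a, MulAction.mem_orbit a s⟩ =
        s * f ⟨a, MulAction.mem_orbit_self a⟩ := fun s =>
      f.map_smul s ⟨a, MulAction.mem_orbit_self a⟩
    refine ⟨f ⟨a, MulAction.mem_orbit_self a⟩, ?_, hf, fun s t h => ?_⟩
    · rw [← key]
      simp only [hf]
    · rw [← key, ← key]
      simp only [h]
  · rintro ⟨e, he, hea, h⟩
    choose g hg using fun x : MulAction.orbit S a => x.2
    replace hg : ∀ x : MulAction.orbit S a, g x • a = x := hg
    refine ⟨⟨fun x => g x * e, fun s x => ?_⟩, ?_⟩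
    · change g (s • x) * e = s * (g x * e)
      rw [← mul_assoc]
      apply h
      rw [hg, mul_smul, hg]
      rfl
    · change (g _ * e) • a = a
      rw [mul_smul, hea, hg]

theorem mem_regularPart_of_mul {x : S} (s : S) (hx : x ∈ regularPart S) :
    s * x ∈ regularPart S := by
  obtain ⟨P, hP, h⟩ := hx
  exact ⟨P, hP, P.smul_mem s h⟩

theorem IsRegularAct.exists_idempotent {A : Type v} [MulAction S A] (hA : IsRegularAct S A)
    (a : A) : ∃ e ∈ regularPart S, e * e = e ∧ e • a = a := by
  obtain ⟨e, he, hea, h⟩ := (isActRegularElement_iff a).1 (hA a)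
  -- `S e` is isomorphic to `S a`, hence is a regular subact of `S`, and it contains `e`.
  refine ⟨e, ⟨⟨Set.range fun s : S => s * e, ?_⟩, ?_, ⟨1, one_mul e⟩⟩, he, hea⟩
  · rintro c - ⟨s, rfl⟩
    exact ⟨c * s, mul_assoc c s e⟩
  · rintro ⟨-, s, rfl⟩
    obtain ⟨g, hg, hga, h'⟩ := (isActRegularElement_iff (s • a)).1 (hA (s • a))
    refine (isActRegularElement_iff _).2 ⟨g, hg, Subtype.ext ?_, fun t t' ht => h' t t' ?_⟩
    · change g * (s * e) = s * e
      rw [← mul_assoc]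
      exact h _ _ (by rw [mul_smul, hga])
    · have ht : t * (s * e) = t' * (s * e) := congrArg Subtype.val ht
      calc t • s • a = (t * (s * e)) • a := by rw [mul_smul, mul_smul, hea]
        _ = t' • s • a := by rw [ht, mul_smul, mul_smul, hea]

variable (S) in
/-- The union of all regular subacts of `S`, as a subact. -/
def regularSubact : SubMulAction S S where
  carrier := regularPart S
  smul_mem' s _ hx := mem_regularPart_of_mul s hx

theorem isRegularAct_regularSubact : IsRegularAct S (regularSubact S) := by
  rintro ⟨x, P, hP, hx⟩
  obtain ⟨e, he, hex, h⟩ := (isActRegularElement_iff (⟨x, hx⟩ : P)).1 (hP ⟨x, hx⟩)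
  refine (isActRegularElement_iff _).2 ⟨e, he, Subtype.ext (congrArg Subtype.val hex :),
    fun s t hst => h s t (Subtype.ext (congrArg Subtype.val hst :))⟩

theorem exists_idempotent_fixing {x : S} (hx : x ∈ regularPart S) :
    ∃ e ∈ regularPart S, e * e = e ∧ e * x = x := by
  obtain ⟨e, he, hee, hex⟩ :=
    (isRegularAct_regularSubact (S := S)).exists_idempotent ⟨x, hx⟩
  exact ⟨e, he, hee, congrArg Subtype.val hex⟩

/-- A finite set of elements of a regular act is fixed by one idempotent, once the idempotents
form a chain. -/
theorem IsLinearlyOrderedSemigroup.exists_fixing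
    (hlin : IsLinearlyOrderedSemigroup (regularPart S)) {e f : S}
    (he : e ∈ regularPart S) (hee : e * e = e) (hf : f ∈ regularPart S) (hff : f * f = f) :
    ∃ g ∈ regularPart S, g * g = g ∧ g * e = e ∧ g * f = f := by
  have aux : ∀ {e f : S} (he : e ∈ regularPart S) (hf : f ∈ regularPart S), e * e = e →
      f * f = f → Set.range (fun t : regularPart S => t * ⟨e, he⟩) ⊆
        Set.range (fun t : regularPart S => t * ⟨f, hf⟩) → f * e = e := by
    intro e f he hf hee hff h
    obtain ⟨r, hr⟩ := h ⟨⟨e, he⟩, rfl⟩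
    have hr : (r : S) * f = e * e := congrArg Subtype.val hr
    rw [← hee, ← hr, mul_left_comm, hff]
  rcases hlin ⟨e, he⟩ ⟨f, hf⟩ with h | h
  · exact ⟨f, hf, hff, aux he hf hee hff h, hff⟩
  · exact ⟨e, he, hee, hee, aux hf he hff hee h⟩

theorem IsLinearlyOrderedSemigroup.exists_factor
    (hlin : IsLinearlyOrderedSemigroup (regularPart S)) {e : S}
    (he : e ∈ regularPart S) (hee : e * e = e) (s t : S) :
    (∃ w, s * e = w * (t * e)) ∨ ∃ w, t * e = w * (s * e) := by
  have aux : ∀ s t : S, Set.range (fun r : regularPart S =>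
      r * ⟨s * e, mem_regularPart_of_mul s he⟩) ⊆ Set.range (fun r : regularPart S =>
      r * ⟨t * e, mem_regularPart_of_mul t he⟩) → ∃ w, s * e = w * (t * e) := by
    intro s t h
    obtain ⟨r, hr⟩ := h ⟨⟨e, he⟩, rfl⟩
    have hr : (r : S) * (t * e) = e * (s * e) := congrArg Subtype.val hr
    exact ⟨r, by rw [hr, mul_left_comm, hee]⟩
  exact (hlin _ _).imp (aux s t) (aux t s)

/-- Any two scalars are comparable with respect to divisibility on any three elements. -/
def DividesLocally (S : Type u) [CommMonoid S] (A : Type v) [MulAction S A] : Prop :=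
  ∀ (s t : S) (x y z : A),
    (∃ w : S, s • x = w • t • x ∧ s • y = w • t • y ∧ s • z = w • t • z) ∨
    ∃ w : S, t • x = w • s • x ∧ t • y = w • s • y ∧ t • z = w • s • z

theorem IsRegularAct.dividesLocally {A : Type v} [MulAction S A] (hA : IsRegularAct S A)
    (hlin : IsLinearlyOrderedSemigroup (regularPart S)) : DividesLocally S A := by
  intro s t x y z
  obtain ⟨e₁, h₁, i₁, hx⟩ := hA.exists_idempotent x
  obtain ⟨e₂, h₂, i₂, hy⟩ := hA.exists_idempotent y
  obtain ⟨e₃, h₃, i₃, hz⟩ := hA.exists_idempotent z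
  obtain ⟨f, hf, hff, hf₁, hf₂⟩ := hlin.exists_fixing h₁ i₁ h₂ i₂
  obtain ⟨g, hg, hgg, hgf, hg₃⟩ := hlin.exists_fixing hf hff h₃ i₃
  have hx : g • x = x := by
    rw [← hx, ← mul_smul, ← hf₁, ← mul_assoc, hgf]
  have hy : g • y = y := by
    rw [← hy, ← mul_smul, ← hf₂, ← mul_assoc, hgf]
  have hz : g • z = z := by
    rw [← hz, ← mul_smul, hg₃]
  have aux : ∀ s t w : S, s * g = w * (t * g) → ∀ a : A, g • a = a → s • a = w • t • a := by
    intro s t w h a ha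
    calc s • a = (s * g) • a := by rw [mul_smul, ha]
      _ = w • t • a := by rw [h, mul_smul, mul_smul, ha]
  rcases hlin.exists_factor hg hgg s t with ⟨w, hw⟩ | ⟨w, hw⟩
  · exact Or.inl ⟨w, aux s t w hw x hx, aux s t w hw y hy, aux s t w hw z hz⟩
  · exact Or.inr ⟨w, aux t s w hw x hx, aux t s w hw y hy, aux t s w hw z hz⟩

/-! ### The Mal'cev operation. -/

open Classical in
/-- A conservative Mal'cev operation on an act: it returns `c` if every scalar identifying `a`
with `c` also identifies `a` with `b`, and it returns `b` otherwise. -/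
noncomputable def malcev (S : Type u) [CommMonoid S] {A : Type v} [MulAction S A] (a b c : A) : A :=
  if ∀ t : S, t • a = t • c → t • a = t • b then c else b

variable {A : Type v} [MulAction S A]

theorem malcev_self_left (a c : A) : malcev S a a c = c := by
  simp [malcev]

theorem malcev_self_right (a b : A) : malcev S a b a = b := by
  unfold malcev
  split_ifs with h
  · simpa using h 1 rfl
  · rfl

theorem malcev_eq_or (a b c : A) : malcev S a b c = b ∨ malcev S a b c = c := by
  unfold malcev
  split_ifs <;> simp

/-- The mixed case, where the operation picks `u₃` on one side and `v₂` on the other. A scalar `q`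
witnessing the failure on the `v`s cannot be a multiple of `t` there, since `hu` would transfer
through `s`. So `t` is a multiple of `q`, and `t • v₁ = t • v₃` makes all the values `s • uᵢ`
coincide. -/
theorem DividesLocally.smul_eq_smul_of_not (hA : DividesLocally S A) {s t : S}
    {u₁ u₂ u₃ v₁ v₂ v₃ : A} (h₁ : s • u₁ = t • v₁) (h₂ : s • u₂ = t • v₂) (h₃ : s • u₃ = t • v₃)
    (hu : ∀ q : S, q • u₁ = q • u₃ → q • u₁ = q • u₂)
    (hv : ¬ ∀ q : S, q • v₁ = q • v₃ → q • v₁ = q • v₂) : s • u₃ = t • v₂ := by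
  push Not at hv
  obtain ⟨q, hq₃, hq₂⟩ := hv
  rcases hA q t v₁ v₂ v₃ with ⟨w, w₁, w₂, w₃⟩ | ⟨w, w₁, w₂, w₃⟩
  · refine absurd ?_ hq₂
    have := hu (w * s) (by simp only [mul_smul, h₁, h₃, ← w₁, ← w₃, hq₃])
    simpa only [mul_smul, h₁, h₂, ← w₁, ← w₂] using this
  · have : s • u₁ = s • u₃ := by rw [h₁, h₃, w₁, w₃, hq₃]
    rw [← this, hu s this, h₂]

theorem DividesLocally.malcev_smul_eq (hA : DividesLocally S A) {s t : S}
    {u₁ u₂ u₃ v₁ v₂ v₃ : A} (h₁ : s • u₁ = t • v₁) (h₂ : s • u₂ = t • v₂)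
    (h₃ : s • u₃ = t • v₃) : s • malcev S u₁ u₂ u₃ = t • malcev S v₁ v₂ v₃ := by
  unfold malcev
  split_ifs with hu hv hv
  · exact h₃
  · exact hA.smul_eq_smul_of_not h₁ h₂ h₃ hu hv
  · exact (hA.smul_eq_smul_of_not h₁.symm h₂.symm h₃.symm hv hu).symm
  · exact h₂

end Algebra

/-! ### Primitive formulas under the Mal'cev operation; primitive normality. -/

section Formulas

variable {S : Type u} [CommMonoid S] {C : Type w} [(actLanguage S).Structure C] [MulAction S C]

variable (S C) in
/-- The structure on `C` is the one given by the action of `S`. -/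
def IsActStructure : Prop :=
  ∀ (s : S) (a : C),
    Structure.funMap (L := actLanguage S) (ActFunctions.smul s) ![a] = s • a

theorem IsActStructure.funMap_eq (hC : IsActStructure S C) (s : S) (v : Fin 1 → C) :
    Structure.funMap (L := actLanguage S) (ActFunctions.smul s) v = s • v 0 := by
  rw [← hC]
  congr 1
  ext i
  rw [Subsingleton.elim i 0]
  rfl

theorem IsActStructure.exists_term_realize (hC : IsActStructure S C) {β : Type*}
    (t : (actLanguage S).Term β) : ∃ (s : S) (b : β), ∀ v : β → C, t.realize v = s • v b := by
  induction t with
  | var b => exact ⟨1, b, fun v => (one_smul S (v b)).symm⟩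
  | func f ts ih =>
    cases f with
    | smul s =>
      obtain ⟨t, b, h⟩ := ih 0
      refine ⟨s * t, b, fun v => ?_⟩
      refine (hC.funMap_eq s fun i => (ts i).realize v).trans ?_
      rw [h, mul_smul]

theorem IsActStructure.malcev_realize_bounded (hC : IsActStructure S C) (hA : DividesLocally S C)
    {α : Type*} {n : ℕ} {φ : (actLanguage S).BoundedFormula α n} (hφ : IsConjAtomic φ)
    {v₁ v₂ v₃ : α → C} {x₁ x₂ x₃ : Fin n → C} (h₁ : φ.Realize v₁ x₁) (h₂ : φ.Realize v₂ x₂)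
    (h₃ : φ.Realize v₃ x₃) :
    φ.Realize (fun i => malcev S (v₁ i) (v₂ i) (v₃ i))
      (fun i => malcev S (x₁ i) (x₂ i) (x₃ i)) := by
  induction hφ with
  | atomic h =>
    cases h with
    | equal t₁ t₂ =>
      obtain ⟨s, b, hs⟩ := hC.exists_term_realize t₁
      obtain ⟨t, c, ht⟩ := hC.exists_term_realize t₂
      simp only [BoundedFormula.realize_bdEqual, hs, ht] at h₁ h₂ h₃ ⊢
      have := hA.malcev_smul_eq h₁ h₂ h₃
      rcases b with b | b <;> rcases c with c | c <;> exact this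
    | rel R => exact R.elim
  | inf _ _ ih ih' =>
    rw [BoundedFormula.realize_inf] at h₁ h₂ h₃ ⊢
    exact ⟨ih h₁.1 h₂.1 h₃.1, ih' h₁.2 h₂.2 h₃.2⟩

/-- Primitive formulas are preserved by the Mal'cev operation. -/
theorem IsActStructure.malcev_realize (hC : IsActStructure S C) (hA : DividesLocally S C)
    {α : Type*} {φ : (actLanguage S).Formula α} (hφ : IsPrimitiveFormula φ)
    {v₁ v₂ v₃ v : α → C} (h₁ : φ.Realize v₁) (h₂ : φ.Realize v₂) (h₃ : φ.Realize v₃)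
    (hv : ∀ i, v i = malcev S (v₁ i) (v₂ i) (v₃ i)) : φ.Realize v := by
  obtain ⟨m, ψ, hψ, rfl⟩ := hφ
  rw [BoundedFormula.realize_exs] at h₁ h₂ h₃ ⊢
  obtain ⟨x₁, h₁⟩ := h₁
  obtain ⟨x₂, h₂⟩ := h₂
  obtain ⟨x₃, h₃⟩ := h₃
  rw [funext hv]
  exact ⟨_, hC.malcev_realize_bounded hA hψ h₁ h₂ h₃⟩

theorem IsActStructure.solutionSet_subset (hC : IsActStructure S C) (hA : DividesLocally S C)
    {n m : ℕ} {φ : (actLanguage S).Formula (Fin n ⊕ Fin m)} (hφ : IsPrimitiveFormula φ)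
    {a b : Fin m → C} {c : Fin n → C} (ha : c ∈ solutionSet C φ a) (hb : c ∈ solutionSet C φ b) :
    solutionSet C φ a ⊆ solutionSet C φ b := by
  intro d hd
  -- Coordinatewise, `(d, b) = m((c, a), (c, b), (d, a))`.
  refine hC.malcev_realize hA hφ ha hb hd ?_
  rintro (i | i)
  · exact (malcev_self_left _ _).symm
  · exact (malcev_self_right _ _).symm

theorem IsActStructure.primitiveCopiesEqOrDisjoint (hC : IsActStructure S C)
    (hA : DividesLocally S C) : PrimitiveCopiesEqOrDisjoint (actLanguage S) C := by
  rintro n - - ⟨m, φ, a, b, hφ, rfl, rfl⟩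
  rw [or_iff_not_imp_right, ← Ne, ← Set.nonempty_iff_ne_empty]
  rintro ⟨c, ha, hb⟩
  exact (hC.solutionSet_subset hA hφ ha hb).antisymm (hC.solutionSet_subset hA hφ hb ha)

theorem IsActStructure.malcev_mem_of_isDeltaPrimitiveSet (hC : IsActStructure S C)
    (hA : DividesLocally S C) {n : ℕ} {X : Set (Fin n → C)}
    (hX : IsDeltaPrimitiveSet (actLanguage S) C X) {x y z : Fin n → C} (hx : x ∈ X) (hy : y ∈ X)
    (hz : z ∈ X) : (fun i => malcev S (x i) (y i) (z i)) ∈ X := by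
  obtain ⟨F, hF, rfl⟩ := hX
  intro Y hY
  obtain ⟨m, φ, a, hφ, rfl⟩ := hF Y hY
  refine hC.malcev_realize hA hφ (hx _ hY) (hy _ hY) (hz _ hY) ?_
  rintro (i | i)
  · rfl
  · exact (malcev_self_left _ _).symm

end Formulas

/-! ### Growth of finitely generated subgroups of infinite abelian groups. -/

section Growth

theorem neg_mem_of_finite_of_add_mem {G : Type*} [AddCommGroup G] {F : Set G} (hF : F.Finite)
    (h0 : (0 : G) ∈ F) (hadd : ∀ x ∈ F, ∀ y ∈ F, x + y ∈ F) {x : G} (hx : x ∈ F) : -x ∈ F := by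
  let M : AddSubmonoid G := ⟨⟨F, fun {a b} ha hb => hadd a ha b hb⟩, h0⟩
  have hle : AddSubmonoid.multiples x ≤ M := (AddSubmonoid.multiples_le (P := M)).2 hx
  have hfin : IsOfFinAddOrder x := finite_multiples.1 (hF.subset hle)
  exact hle (hfin.mem_multiples_iff_mem_zmultiples.2
    (neg_mem (AddSubgroup.mem_zmultiples x)))

/-- A generator chosen outside a finite subgroup at least doubles its order, by Lagrange. -/
theorem exists_finset_two_pow_le_card_closure {G : Type*} [AddCommGroup G] [Infinite G]
    (hfin : ∀ s : Finset G, Finite (AddSubgroup.closure (s : Set G))) (k : ℕ) :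
    ∃ s : Finset G, s.card ≤ k ∧ 2 ^ k ≤ Nat.card (AddSubgroup.closure (s : Set G)) := by
  classical
  induction k with
  | zero =>
    have := hfin ∅
    exact ⟨∅, le_rfl, Nat.card_pos⟩
  | succ k ih =>
    obtain ⟨s, hs, hcard⟩ := ih
    have hs' := hfin s
    obtain ⟨g, hg⟩ := (Set.toFinite (AddSubgroup.closure (s : Set G) : Set G)).exists_notMem
    refine ⟨insert g s, (Finset.card_insert_le g s).trans (by lia), ?_⟩
    have := hfin (insert g s)
    have hle : AddSubgroup.closure (s : Set G) ≤ AddSubgroup.closure ((insert g s : Finset G)) :=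
      AddSubgroup.closure_mono (by simp)
    obtain ⟨c, hc⟩ := AddSubgroup.card_dvd_of_le hle
    have hpos : 0 < Nat.card (AddSubgroup.closure ((insert g s : Finset G) : Set G)) :=
      Nat.card_pos
    have hc2 : 2 ≤ c := by
      by_contra! h
      interval_cases c
      · lia
      · have := AddSubgroup.eq_of_le_of_card_ge hle (by lia)
        exact hg (this ▸ AddSubgroup.subset_closure (by simp))
    rw [hc, pow_succ]
    exact Nat.mul_le_mul hcard hc2

/-- In an infinite abelian group the finite sets closed under addition and containing a given
set with `k` elements are not of polynomial size in `k`. -/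
theorem not_polynomial_growth {G : Type*} [AddCommGroup G] [Infinite G] (n : ℕ)
    (h : ∀ s : Finset G, ∃ F : Set G, F.Finite ∧ (s : Set G) ⊆ F ∧ (0 : G) ∈ F ∧
      (∀ x ∈ F, ∀ y ∈ F, x + y ∈ F) ∧ F.ncard ≤ (s.card + 1) ^ n) : False := by
  have key : ∀ s : Finset G, Finite (AddSubgroup.closure (s : Set G)) ∧
      Nat.card (AddSubgroup.closure (s : Set G)) ≤ (s.card + 1) ^ n := by
    intro s
    obtain ⟨F, hF, hsF, h0, hadd, hcard⟩ := h s
    let M : AddSubgroup G := ⟨⟨⟨F, fun {a b} ha hb => hadd a ha b hb⟩, h0⟩,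
      fun {x} hx => neg_mem_of_finite_of_add_mem hF h0 hadd hx⟩
    have hle : AddSubgroup.closure (s : Set G) ≤ M := (AddSubgroup.closure_le M).2 hsF
    exact ⟨hF.subset hle, (Set.ncard_le_ncard hle hF).trans hcard⟩
  have hlim := tendsto_pow_const_div_const_pow_of_one_lt n (one_lt_two (α := ℝ))
  -- Evaluating at `k + 1` with bound `1/2` gives `(k + 1) ^ n < 2 ^ k`.
  have hlim := (hlim.comp (Filter.tendsto_add_atTop_nat 1)).eventually
    (gt_mem_nhds (show (0 : ℝ) < 2⁻¹ by norm_num))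
  obtain ⟨k, hk⟩ := hlim.exists
  obtain ⟨s, hs, hcard⟩ := exists_finset_two_pow_le_card_closure (fun s => (key s).1) k
  have h2 : 2 ^ k ≤ (k + 1) ^ n :=
    hcard.trans ((key s).2.trans (Nat.pow_le_pow_left (by lia) n))
  have h3 : (2 : ℝ) ^ k ≤ ((k + 1 : ℕ) : ℝ) ^ n := by exact_mod_cast h2
  simp only [Function.comp_apply] at hk
  rw [div_lt_iff₀ (by positivity), pow_succ] at hk
  linarith

end Growth

/-! ### Absence of infinite primitive groups. -/

section Groups

variable {S : Type u} [CommMonoid S] {C : Type w} [(actLanguage S).Structure C] [MulAction S C]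

theorem IsActStructure.noInfinitePrimitiveGroup (hC : IsActStructure S C)
    (hA : DividesLocally S C) : NoInfinitePrimitiveGroup (actLanguage S) C := by
  classical
  rintro n r X ⟨hX, -, -⟩ hinf ⟨_, m, φ, d, hφ, hadd⟩
  have : Infinite (quotientSet r X) := hinf.to_subtype
  choose rep hrepX hrep using fun g : quotientSet r X => g.2
  let cls : X → quotientSet r X := fun x => ⟨classOf r x.1, x.1, x.2, rfl⟩
  have hcls : ∀ g, cls ⟨rep g, hrepX g⟩ = g := fun g => Subtype.ext (hrep g)
  have hsum : ∀ y z : X, ∃ w : X, (∀ i, w.1 i = y.1 i ∨ w.1 i = z.1 i) ∧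
      cls z + cls y = cls w := by
    intro y z
    let o : X := ⟨rep 0, hrepX 0⟩
    have ho : cls o = 0 := hcls 0
    -- Applying `m` to `0 + 0 = 0`, `0 + y = y` and `z + 0 = z` yields `z + y = m(0, y, z)`.
    have h₁ := (hadd o o o).2 (show cls o + cls o = cls o by simp [ho])
    have h₂ := (hadd o y y).2 (show cls o + cls y = cls y by simp [ho])
    have h₃ := (hadd z o z).2 (show cls z + cls o = cls z by simp [ho])
    let w : X := ⟨_, hC.malcev_mem_of_isDeltaPrimitiveSet hA hX o.2 y.2 z.2⟩
    refine ⟨w, fun i => malcev_eq_or _ _ _, (hadd z y w).1 ?_⟩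
    refine hC.malcev_realize hA hφ h₁ h₂ h₃ ?_
    rintro (i | i | i | i)
    · exact (malcev_self_left _ _).symm
    · exact (malcev_self_right _ _).symm
    · rfl
    · exact (malcev_self_left _ _).symm
  refine not_polynomial_growth (G := quotientSet r X) n fun s => ?_
  -- A box: at each position at most `s.card + 1` values, so conservativity keeps sums inside it.
  let Y : Finset (Fin n → C) :=
    Fintype.piFinset fun i => (insert 0 s).image fun g => rep g i
  have hY : ∀ g ∈ insert 0 s, rep g ∈ Y := fun g hg =>
    Fintype.mem_piFinset.2 fun i => Finset.mem_image_of_mem _ hg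
  let F : Set (quotientSet r X) := {g | ∃ y : X, y.1 ∈ Y ∧ cls y = g}
  have himage : Subtype.val '' F ⊆ classOf r '' (Y : Set (Fin n → C)) := by
    rintro - ⟨-, ⟨y, hy, rfl⟩, rfl⟩
    exact ⟨y, hy, rfl⟩
  have hfin : (classOf r '' (Y : Set (Fin n → C))).Finite := Y.finite_toSet.image _
  refine ⟨F, (hfin.subset himage).of_finite_image Subtype.val_injective.injOn, ?_, ?_, ?_, ?_⟩
  · exact fun g hg => ⟨⟨rep g, hrepX g⟩, hY g (Finset.mem_insert_of_mem hg), hcls g⟩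
  · exact ⟨⟨rep 0, hrepX 0⟩, hY 0 (Finset.mem_insert_self _ _), hcls 0⟩
  · rintro - ⟨z, hz, rfl⟩ - ⟨y, hy, rfl⟩
    obtain ⟨w, hw, hsum⟩ := hsum y z
    refine ⟨w, Fintype.mem_piFinset.2 fun i => ?_, hsum.symm⟩
    rcases hw i with h | h <;> rw [h]
    · exact Fintype.mem_piFinset.1 hy i
    · exact Fintype.mem_piFinset.1 hz i
  · calc F.ncard = (Subtype.val '' F).ncard :=
          (Set.ncard_image_of_injective F Subtype.val_injective).symm
      _ ≤ (classOf r '' (Y : Set (Fin n → C))).ncard := Set.ncard_le_ncard himage hfin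
      _ ≤ (Y : Set (Fin n → C)).ncard := Set.ncard_image_le Y.finite_toSet
      _ = ∏ i : Fin n, ((insert 0 s).image fun g => rep g i).card := by
          rw [Set.ncard_coe_finset, Fintype.card_piFinset]
      _ ≤ ∏ _i : Fin n, (s.card + 1) := Finset.prod_le_prod' fun i _ =>
          Finset.card_image_le.trans (Finset.card_insert_le _ _)
      _ = (s.card + 1) ^ n := by simp

end Groups

/-! ### Models of the theory of regular acts and the test formula. -/

section Models

variable {S : Type u} [CommMonoid S]

variable (S) in
/-- An act as a structure of the language of acts. -/
@[reducible]
def actStructure (A : Type w) [MulAction S A] : (actLanguage S).Structure A where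
  funMap f v := match f with
    | ActFunctions.smul s => s • v 0
  RelMap r := r.elim

theorem mem_regularActs_of_model
    (hax : IsAxiomatizable (regularActs S)) (C : Theory.ModelType.{u, 0, u}
      (theoryOfClass (regularActs S))) :
    ∃ _ : MulAction S C, IsActStructure S C ∧ IsRegularAct S C := by
  obtain ⟨T, hT⟩ := hax
  have hmodel : C ⊨ T := by
    refine ⟨fun φ hφ => ?_⟩
    -- The axioms of the class belong to its theory, so its models are regular acts.
    have : φ ∈ theoryOfClass (regularActs S) := fun A hA =>
      ((hT A).1 hA).2.realize_of_mem φ hφ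
    exact C.is_model.realize_of_mem φ this
  exact ((hT ⟨C, C.struc⟩).2 ⟨C.nonempty', hmodel⟩).2

theorem primitiveCopies_of_isRegularAct (h : ClassPrimitiveNormal (regularActs S))
    (A : Type u) [Nonempty A] [MulAction S A] (hA : IsRegularAct S A) :
    letI := actStructure S A
    PrimitiveCopiesEqOrDisjoint (actLanguage S) A := by
  let := actStructure S A
  have hmem : (⟨A, actStructure S A⟩ : Bundled (actLanguage S).Structure) ∈ regularActs S :=
    ⟨‹_›, ‹_›, fun _ _ => rfl, hA⟩
  have : A ⊨ theoryOfClass (regularActs S) := ⟨fun φ hφ => hφ _ hmem⟩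
  exact h (Theory.ModelType.of _ A)

/-- The formula `∃ z, x = a z ∧ y = b z`. -/
def linkFormula {S : Type u} (a b : S) : (actLanguage S).Formula (Fin 1 ⊕ Fin 1) :=
  BoundedFormula.exs (n := 1)
    ((Term.var (Sum.inl (Sum.inl 0))).bdEqual
        (Term.func (L := actLanguage S) (ActFunctions.smul a) fun _ => Term.var (Sum.inr 0)) ⊓
      (Term.var (Sum.inl (Sum.inr 0))).bdEqual
        (Term.func (L := actLanguage S) (ActFunctions.smul b) fun _ => Term.var (Sum.inr 0)))

theorem isPrimitiveFormula_linkFormula {S : Type u} (a b : S) : IsPrimitiveFormula (linkFormula a b) :=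
  ⟨1, _, .inf (.atomic (.equal _ _)) (.atomic (.equal _ _)), rfl⟩

theorem realize_linkFormula {A : Type w} [MulAction S A] (a b : S) (x y : Fin 1 → A) :
    letI := actStructure S A
    (linkFormula a b).Realize (Sum.elim x y) ↔ ∃ z : A, x 0 = a • z ∧ y 0 = b • z := by
  let := actStructure S A
  rw [linkFormula, BoundedFormula.realize_exs]
  simp only [BoundedFormula.realize_inf, BoundedFormula.realize_bdEqual, Term.realize_var,
    Sum.elim_inl, Sum.elim_inr]
  exact ⟨fun ⟨z, h⟩ => ⟨z 0, h⟩, fun ⟨z, h⟩ => ⟨fun _ => z, h⟩⟩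

/-- The copies with parameters `b • z₁` and `b • z₂` share `a • z₁ = a • z₂`, so they are equal; the
first contains `a • z₃`, hence so does the second. -/
theorem exists_link (h : ClassPrimitiveNormal (regularActs S))
    {A : Type u} [MulAction S A] (hA : IsRegularAct S A) (a b : S) {z₁ z₂ z₃ : A}
    (ha : a • z₁ = a • z₂) (hb : b • z₁ = b • z₃) : ∃ z : A, a • z = a • z₃ ∧ b • z = b • z₂ := by
  have : Nonempty A := ⟨z₁⟩
  let := actStructure S A
  have hmem : ∀ x y : A, (fun _ => x) ∈ solutionSet A (linkFormula a b) (fun _ : Fin 1 => y) ↔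
      ∃ z : A, x = a • z ∧ y = b • z := fun x y => realize_linkFormula a b _ _
  rcases primitiveCopies_of_isRegularAct h A hA 1 _ _
    ⟨1, linkFormula a b, fun _ => b • z₁, fun _ => b • z₂, isPrimitiveFormula_linkFormula a b,
      rfl, rfl⟩ with h' | h'
  · have h₃ : (fun _ => a • z₃) ∈ solutionSet A (linkFormula a b) (fun _ : Fin 1 => b • z₁) :=
      (hmem _ _).2 ⟨z₃, rfl, hb⟩
    rw [h', hmem] at h₃
    obtain ⟨z, hz, hz'⟩ := h₃
    exact ⟨z, hz.symm, hz'.symm⟩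
  · have h₁ := (hmem (a • z₁) (b • z₁)).2 ⟨z₁, rfl, rfl⟩
    have h₂ := (hmem (a • z₁) (b • z₂)).2 ⟨z₂, ha, rfl⟩
    exact absurd (Set.mem_inter h₁ h₂) (h' ▸ Set.notMem_empty _)

end Models

/-! ### Amalgams of copies of an act. -/

section Gluing

variable {S : Type u} [CommMonoid S] {ι : Type*} {A : Type v} [MulAction S A]

/-- Copies of `A` indexed by `ι`, where the copies `i` and `j` are glued along `I i ⊓ I j`. -/
def glueSetoid (I : ι → SubMulAction S A) : Setoid (ι × A) where
  r p q := p.2 = q.2 ∧ (p.1 = q.1 ∨ p.2 ∈ I p.1 ∧ p.2 ∈ I q.1)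
  iseqv := by
    refine ⟨fun p => ⟨rfl, Or.inl rfl⟩, ?_, ?_⟩
    · rintro ⟨i, x⟩ ⟨j, -⟩ ⟨rfl, h⟩
      exact ⟨rfl, h.imp Eq.symm And.symm⟩
    · rintro ⟨i, x⟩ ⟨j, -⟩ ⟨k, -⟩ ⟨rfl, h⟩ ⟨rfl, h'⟩
      refine ⟨rfl, ?_⟩
      rcases h with rfl | h
      · exact h'
      · rcases h' with rfl | h'
        · exact Or.inr h
        · exact Or.inr ⟨h.1, h'.2⟩

/-- The act obtained by gluing copies of `A`. -/
def Glue (I : ι → SubMulAction S A) : Type _ := Quotient (glueSetoid I)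

namespace Glue

variable (I : ι → SubMulAction S A)

/-- The element of the copy `i` given by `x`. -/
def mk (i : ι) (x : A) : Glue I := Quotient.mk (glueSetoid I) (i, x)

variable {I}

theorem mk_eq_mk {i j : ι} {x y : A} :
    mk I i x = mk I j y ↔ x = y ∧ (i = j ∨ x ∈ I i ∧ x ∈ I j) :=
  Quotient.eq (r := glueSetoid I)

theorem exists_mk (z : Glue I) : ∃ i x, mk I i x = z := by
  obtain ⟨⟨i, x⟩, h⟩ := Quotient.exists_rep z
  exact ⟨i, x, h⟩

instance : MulAction S (Glue I) where
  smul s := Quotient.map (fun p => (p.1, s • p.2)) (by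
    rintro ⟨i, x⟩ ⟨j, -⟩ ⟨rfl, h⟩
    exact ⟨rfl, h.imp id fun h => ⟨(I i).smul_mem s h.1, (I j).smul_mem s h.2⟩⟩)
  one_smul z := by
    obtain ⟨i, x, rfl⟩ := exists_mk z
    exact congrArg (mk I i) (one_smul S x)
  mul_smul s t z := by
    obtain ⟨i, x, rfl⟩ := exists_mk z
    exact congrArg (mk I i) (mul_smul s t x)

theorem smul_mk (s : S) (i : ι) (x : A) : s • mk I i x = mk I i (s • x) := rfl

/-- Equal elements of the amalgam have equal projections to `A`, so the idempotent for `x` serves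
every copy of `x`. -/
theorem isRegularAct (hA : IsRegularAct S A) : IsRegularAct S (Glue I) := by
  intro z
  obtain ⟨i, x, rfl⟩ := exists_mk z
  obtain ⟨e, he, hex, h⟩ := (isActRegularElement_iff x).1 (hA x)
  refine (isActRegularElement_iff _).2 ⟨e, he, by rw [smul_mk, hex], fun s t hst => h s t ?_⟩
  rw [smul_mk, smul_mk, mk_eq_mk] at hst
  exact hst.1

end Glue

end Gluing

/-! ### Primitive normality forces linear order. -/

section Linear

variable {S : Type u} [CommMonoid S]

theorem exists_upper_bound (h : ClassPrimitiveNormal (regularActs S)) {e f : S}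
    (he : e ∈ regularPart S) (hee : e * e = e) (hf : f ∈ regularPart S) (hff : f * f = f) :
    ∃ g ∈ regularPart S, g * e = e ∧ g * f = f := by
  let E : regularSubact S := ⟨e, he⟩
  let F : regularSubact S := ⟨f, hf⟩
  -- The link `z` satisfies `e z = e` and `f z = f`, so any idempotent fixing `z` lies above both.
  obtain ⟨⟨z, hz⟩, h₁, h₂⟩ := exists_link h isRegularAct_regularSubact e f
    (z₁ := e • F) (z₂ := F) (z₃ := E)
    (Subtype.ext (show e * (e * f) = e * f by rw [← mul_assoc, hee]))
    (Subtype.ext (show f * (e * f) = f * e by rw [mul_left_comm, hff, mul_comm]))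
  have h₁ : e * z = e * e := congrArg Subtype.val h₁
  have h₂ : f * z = f * f := congrArg Subtype.val h₂
  obtain ⟨g, hg, -, hgz⟩ := exists_idempotent_fixing hz
  exact ⟨g, hg, by rw [← hee, ← h₁, mul_left_comm, hgz],
    by rw [← hff, ← h₂, mul_left_comm, hgz]⟩

theorem dvd_or_dvd_of_mul (h : ClassPrimitiveNormal (regularActs S)) {g : S}
    (hg : g ∈ regularPart S) (a b : S) : b * g ∣ a * g ∨ a * g ∣ b * g := by
  let E : regularSubact S := ⟨g, hg⟩
  -- Copy 0 meets copy 1 exactly in `S a g` and copy 2 exactly in `S b g`.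
  let I : Fin 3 → SubMulAction S (regularSubact S) :=
    ![⊤, ⟨MulAction.orbit S (a • E), fun s _ hx => MulAction.mem_orbit_of_mem_orbit s hx⟩,
      ⟨MulAction.orbit S (b • E), fun s _ hx => MulAction.mem_orbit_of_mem_orbit s hx⟩]
  have h1 : ∀ x, x ∈ I 1 ↔ x ∈ MulAction.orbit S (a • E) := fun _ => Iff.rfl
  have h2 : ∀ x, x ∈ I 2 ↔ x ∈ MulAction.orbit S (b • E) := fun _ => Iff.rfl
  obtain ⟨z, ha, hb⟩ := exists_link h
    (Glue.isRegularAct (I := I) isRegularAct_regularSubact) a b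
    (z₁ := Glue.mk I 0 E) (z₂ := Glue.mk I 1 E) (z₃ := Glue.mk I 2 E)
    (Glue.mk_eq_mk.2 ⟨rfl, Or.inr ⟨trivial, MulAction.mem_orbit_self _⟩⟩)
    (Glue.mk_eq_mk.2 ⟨rfl, Or.inr ⟨trivial, MulAction.mem_orbit_self _⟩⟩)
  obtain ⟨i, x, rfl⟩ := Glue.exists_mk z
  rw [Glue.smul_mk, Glue.smul_mk, Glue.mk_eq_mk] at ha hb
  obtain ⟨ha, ha'⟩ := ha
  obtain ⟨hb, hb'⟩ := hb
  rw [ha, h2] at ha'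
  rw [hb, h1] at hb'
  -- If the link lies outside copy 2, then `a g ∈ S b g`; if inside, its multiple by `b` also lies
  -- in copy 1, so `b g ∈ S a g`.
  rcases ha' with rfl | ⟨-, s, hs⟩
  · rcases hb' with hi | ⟨-, s, hs⟩
    · exact absurd hi (by decide)
    · have hs : s * (a * g) = b * g := congrArg Subtype.val hs
      exact Or.inr ⟨s, by rw [← hs, mul_comm]⟩
  · have hs : s * (b * g) = a * g := congrArg Subtype.val hs
    exact Or.inl ⟨s, by rw [← hs, mul_comm]⟩

theorem range_subset_of_dvd {a b : regularPart S} (h : (b : S) ∣ a) :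
    Set.range (fun t : regularPart S => t * a) ⊆ Set.range (fun t : regularPart S => t * b) := by
  rintro - ⟨t, rfl⟩
  obtain ⟨s, hs⟩ := h
  refine ⟨⟨s * t, mem_regularPart_of_mul s t.2⟩, Subtype.ext ?_⟩
  change s * t * (b : S) = t * a
  rw [hs, mul_comm s, mul_assoc, mul_comm s]

theorem isLinearlyOrderedSemigroup_of_primitiveNormal
    (h : ClassPrimitiveNormal (regularActs S)) :
    IsLinearlyOrderedSemigroup (regularPart S) := by
  intro a b
  obtain ⟨e, he, hee, hea⟩ := exists_idempotent_fixing a.2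
  obtain ⟨f, hf, hff, hfb⟩ := exists_idempotent_fixing b.2
  obtain ⟨g, hg, hge, hgf⟩ := exists_upper_bound h he hee hf hff
  have ha : (a : S) * g = a := by rw [← hea, mul_right_comm, mul_comm e, hge]
  have hb : (b : S) * g = b := by rw [← hfb, mul_right_comm, mul_comm f, hgf]
  have := dvd_or_dvd_of_mul h hg (a : S) b
  rw [ha, hb] at this
  exact this.imp range_subset_of_dvd range_subset_of_dvd

end Linear

end RegularActs

theorem mainTheorem3 (S : Type u) [CommMonoid S]
    (hR : (RegularActs.regularPart S : Set S).Nonempty)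
    (hax : PrimitiveModelTheory.IsAxiomatizable (RegularActs.regularActs S)) :
    List.TFAE
      [PrimitiveModelTheory.ClassPrimitiveNormal (RegularActs.regularActs S),
       PrimitiveModelTheory.ClassAntiadditive (RegularActs.regularActs S),
       RegularActs.IsLinearlyOrderedSemigroup (RegularActs.regularPart S)] := by
  tfae_have 2 → 1 := And.left
  tfae_have 1 → 3 := RegularActs.isLinearlyOrderedSemigroup_of_primitiveNormal
  tfae_have 3 → 2 := by
    intro hlin
    refine ⟨fun C => ?_, fun C => ?_⟩ <;>
      obtain ⟨_, hC, hA⟩ := RegularActs.mem_regularActs_of_model hax C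
    · exact hC.primitiveCopiesEqOrDisjoint (hA.dividesLocally hlin)
    · exact hC.noInfinitePrimitiveGroup (hA.dividesLocally hlin)
  tfae_finish
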